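/- Let $k \ge 1$ and $\ell \ge 0$ be integers and let $\kappa > 0$. There is a constant $C_I > 0$, depending only on $k$, $\ell$ and $\kappa$, such that the following holds. Let $E \subset \mathbb{R}^2$ be a polygon, i.e. the bounded open region enclosed by a simple closed polygonal curve, with diameter $h_E$, such that 1. $E$ is star-shaped with respect to every point of some ball of radius $\rho \ge \kappa h_E$, and 2. every edge $e$ of $E$ has length $|e| \ge \kappa h_E$. Let $w \in H^1(E)$ be such that its distributional Laplacian $\Delta w$ is (the restriction to $E$ of) a real polynomial in two variables of total degree at most $k+\ell$. Then $$\|\Delta w\|_{L^2(E)} \le C_I\, h_E^{-1}\, \|\nabla w\|_{L^2(E)} .$$ -/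

import Mathlib

open MeasureTheory Metric Set
open scoped ContDiff InnerProductSpace

/-- The Euclidean plane. -/
abbrev Plane : Type := EuclideanSpace ℝ (Fin 2)

/-- `E` is the open region enclosed by the closed polygonal chain `P`, which is a simple closed
curve: the half-open edges, parametrized by `[0, 1)`, are traversed injectively and do not meet
each other. An open, connected, bounded, nonempty set whose frontier is this curve is the bounded
connected component of its complement. Straight angles at vertices are allowed. -/
structure IsPolygonalRegion {n : ℕ} (P : Polygon Plane n) (E : Set Plane) : Prop where
  three_le : 3 ≤ n
  simple : ∀ i j : Fin n, ∀ s ∈ Ico (0 : ℝ) 1, ∀ t ∈ Ico (0 : ℝ) 1,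
    P.edgePath ℝ i s = P.edgePath ℝ j t → i = j ∧ s = t
  isOpen : IsOpen E
  isConnected : IsConnected E
  isBounded : Bornology.IsBounded E
  frontier_eq : frontier E = P.boundary ℝ

/-- Mesh regularity of the polygon `E` with boundary chain `P` and parameter `κ`: `E` is
star-shaped with respect to a ball of radius at least `κ` times its diameter, and all edges have
length at least `κ` times its diameter. -/
structure IsShapeRegular (κ : ℝ) {n : ℕ} (P : Polygon Plane n) (E : Set Plane) : Prop where
  starShaped : ∃ (c : Plane) (ρ : ℝ), κ * diam E ≤ ρ ∧ ∀ y ∈ ball c ρ, StarConvex ℝ y E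
  edge_length : ∀ i : Fin n, κ * diam E ≤ dist (P i) (P (finRotate n i))

/-- `φ` is a test function on `E`, that is `φ ∈ C_c^∞(E)`. -/
structure IsTestFunction (E : Set Plane) (φ : Plane → ℝ) : Prop where
  smooth : ContDiff ℝ ∞ φ
  compact : HasCompactSupport φ
  support : tsupport φ ⊆ E

/-- `g` is the weak (distributional) gradient of `w` on the open set `E`. -/
structure HasWeakGradient (E : Set Plane) (w : Plane → ℝ) (g : Plane → Plane) : Prop where
  locallyIntegrable : LocallyIntegrableOn w E
  locallyIntegrable_grad : LocallyIntegrableOn g E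
  integral_eq : ∀ φ : Plane → ℝ, IsTestFunction E φ → ∀ v : Plane,
    ∫ x in E, w x * fderiv ℝ φ x v = - ∫ x in E, ⟪g x, v⟫_ℝ * φ x

/-- `w` belongs to the Sobolev space `H¹(E)`. -/
def MemH1 (E : Set Plane) (w : Plane → ℝ) : Prop :=
  MemLp w 2 (volume.restrict E) ∧
    ∃ g : Plane → Plane, HasWeakGradient E w g ∧ MemLp g 2 (volume.restrict E)

/-- `f` is the weak (distributional) Laplacian of `w` on the open set `E`. -/
structure HasWeakLaplacian (E : Set Plane) (w f : Plane → ℝ) : Prop where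
  locallyIntegrable : LocallyIntegrableOn w E
  locallyIntegrable_laplacian : LocallyIntegrableOn f E
  integral_eq : ∀ φ : Plane → ℝ, IsTestFunction E φ →
    ∫ x in E, w x * Laplacian.laplacian φ x = ∫ x in E, f x * φ x

/-- The function on the plane given by a real polynomial in two variables. -/
noncomputable def polyFun (p : MvPolynomial (Fin 2) ℝ) (x : Plane) : ℝ :=
  MvPolynomial.eval (fun i => x i) p

/-! Let `p` be the Laplacian, `h` the diameter, and `b` a fixed bump whose copy rescaled by `h` is
supported in a ball inside `E`. Testing the equation with `b² p` gives `‖b p‖² = -∫ ∇w · ∇(b² p)`.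
On the reference configuration the polynomials of bounded degree form a finite-dimensional space on
which `q ↦ ‖b q‖` is a norm, so it dominates both `‖∂ᵢ(b² q)‖` and the norm of `q` on the unit ball
(`exists_inverse_estimate_bump`). Scaling back and dividing by `‖b q‖` yields the factor `h⁻¹`
(`inverse_estimate_of_ball_subset`). The shape of `E` enters only through a ball inside and a ball
outside, so the constant depends only on the degree and `κ`. -/

theorem StarConvex.mem_of_nonempty {y : Plane} {E : Set Plane} (h : StarConvex ℝ y E)
    (hE : E.Nonempty) : y ∈ E := by
  obtain ⟨x, hx⟩ := hE
  simpa using h hx (zero_le_one) le_rfl (add_zero (1 : ℝ))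

/-! ### Linear maps on finite-dimensional spaces -/

/-- The map `T v ↦ S v` is linear on the finite-dimensional range of `T`, hence bounded. -/
theorem LinearMap.exists_norm_le_mul_norm_of_injective {V F G : Type*} [AddCommGroup V]
    [Module ℝ V] [FiniteDimensional ℝ V] [NormedAddCommGroup F] [NormedSpace ℝ F]
    [NormedAddCommGroup G] [NormedSpace ℝ G] (T : V →ₗ[ℝ] F) (hT : Function.Injective T)
    (S : V →ₗ[ℝ] G) : ∃ C : ℝ, 0 < C ∧ ∀ v, ‖S v‖ ≤ C * ‖T v‖ := by
  let A : LinearMap.range T →ₗ[ℝ] G := S ∘ₗ (LinearEquiv.ofInjective T hT).symm.toLinearMap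
  obtain ⟨C, hC, h⟩ := (LinearMap.toContinuousLinearMap A).bound
  refine ⟨C, hC, fun v => ?_⟩
  simpa [A] using h (LinearEquiv.ofInjective T hT v)

/-- A linear family of square-integrable functions, as a linear map into `L²`. -/
noncomputable def linearToL2 {V : Type*} [AddCommGroup V] [Module ℝ V] (f : V →ₗ[ℝ] Plane → ℝ)
    (hf : ∀ v, MemLp (f v) 2 volume) : V →ₗ[ℝ] Lp ℝ 2 (volume : Measure Plane) where
  toFun v := (hf v).toLp (f v)
  map_add' v v' := by
    rw [← MemLp.toLp_add]
    exact MemLp.toLp_congr _ _ (by rw [map_add])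
  map_smul' r v := by
    rw [RingHom.id_apply, ← MemLp.toLp_const_smul]
    exact MemLp.toLp_congr _ _ (by rw [map_smul])

theorem exists_eLpNorm_le_mul_eLpNorm {V : Type*} [AddCommGroup V] [Module ℝ V]
    [FiniteDimensional ℝ V] (f g : V →ₗ[ℝ] Plane → ℝ) (hf : ∀ v, MemLp (f v) 2 volume)
    (hg : ∀ v, MemLp (g v) 2 volume) (hinj : ∀ v, f v =ᵐ[volume] 0 → v = 0) :
    ∃ C : ℝ, 0 < C ∧ ∀ v, eLpNorm (g v) 2 volume ≤ ENNReal.ofReal C * eLpNorm (f v) 2 volume := by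
  have hT : Function.Injective (linearToL2 f hf) := by
    rw [injective_iff_map_eq_zero]
    intro v hv
    exact hinj v ((MemLp.toLp_eq_toLp_iff (hf v) MemLp.zero).1 hv)
  obtain ⟨C, hC, h⟩ :=
    LinearMap.exists_norm_le_mul_norm_of_injective (linearToL2 f hf) hT (linearToL2 g hg)
  refine ⟨C, hC, fun v => ?_⟩
  have h1 := h v
  simp only [linearToL2, LinearMap.coe_mk, AddHom.coe_mk, Lp.norm_toLp] at h1
  rw [← ENNReal.ofReal_toReal (hg v).eLpNorm_ne_top, ← ENNReal.ofReal_toReal (hf v).eLpNorm_ne_top,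
    ← ENNReal.ofReal_mul hC.le]
  exact ENNReal.ofReal_le_ofReal h1

/-! ### Polynomial functions -/

theorem contDiff_polyFun (p : MvPolynomial (Fin 2) ℝ) : ContDiff ℝ ∞ (polyFun p) := by
  have key : ContDiff ℝ ∞ fun x : Plane => MvPolynomial.eval (fun i => x i) p := by
    induction p using MvPolynomial.induction_on with
    | C a => simpa using contDiff_const
    | add p q hp hq => simpa using hp.add hq
    | mul_X p i hp =>
      simp only [map_mul, MvPolynomial.eval_X]
      exact hp.mul (by fun_prop)
  exact key

/-- `polyFun` as a linear map on polynomials of bounded degree. -/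
noncomputable def polyFunLinear (N : ℕ) :
    MvPolynomial.restrictTotalDegree (Fin 2) ℝ N →ₗ[ℝ] Plane → ℝ where
  toFun q := polyFun q
  map_add' p q := by ext x; simp [polyFun]
  map_smul' r q := by ext x; simp [polyFun]

/-- The polynomial `y ↦ p (c + h y)`. -/
noncomputable def rescalePoly (c : Plane) (h : ℝ) (p : MvPolynomial (Fin 2) ℝ) :
    MvPolynomial (Fin 2) ℝ :=
  MvPolynomial.bind₁ (fun i => MvPolynomial.C (c i) + MvPolynomial.C h * MvPolynomial.X i) p

theorem polyFun_rescalePoly (c : Plane) (h : ℝ) (p : MvPolynomial (Fin 2) ℝ) (y : Plane) :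
    polyFun (rescalePoly c h p) y = polyFun p (c + h • y) := by
  unfold polyFun rescalePoly
  induction p using MvPolynomial.induction_on with
  | C a => simp
  | add p q hp hq => simp only [map_add, hp, hq]
  | mul_X p i hp => simp [hp]

theorem totalDegree_rescalePoly_le (c : Plane) (h : ℝ) (p : MvPolynomial (Fin 2) ℝ) :
    (rescalePoly c h p).totalDegree ≤ p.totalDegree := by
  unfold rescalePoly
  conv_lhs => rw [p.as_sum]
  rw [map_sum]
  refine MvPolynomial.totalDegree_finsetSum_le fun d hd => ?_
  rw [MvPolynomial.bind₁_monomial]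
  refine (MvPolynomial.totalDegree_mul _ _).trans ?_
  rw [MvPolynomial.totalDegree_C, zero_add]
  refine (MvPolynomial.totalDegree_finsetProd _ _).trans ?_
  refine le_trans (Finset.sum_le_sum fun i _ => ?_) (MvPolynomial.le_totalDegree hd)
  refine (MvPolynomial.totalDegree_pow _ _).trans ?_
  have : (MvPolynomial.C (c i) + MvPolynomial.C h * MvPolynomial.X i :
      MvPolynomial (Fin 2) ℝ).totalDegree ≤ 1 := by
    refine (MvPolynomial.totalDegree_add _ _).trans (max_le (by simp) ?_)
    refine (MvPolynomial.totalDegree_mul _ _).trans ?_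
    simp
  exact (Nat.mul_le_mul_left _ this).trans (by simp)

theorem eq_zero_of_polyFun_eq_zero_on_ball {p : MvPolynomial (Fin 2) ℝ} {r : ℝ} (hr : 0 < r)
    (h : ∀ x ∈ ball (0 : Plane) r, polyFun p x = 0) : p = 0 := by
  -- A polynomial vanishing on a product of infinite sets is zero; the square `(0, r/2)²` fits in
  -- the ball.
  refine MvPolynomial.funext_set (fun _ => Ioo (0 : ℝ) (r / 2))
    (fun _ => Ioo_infinite (by positivity)) fun x hx => ?_
  rw [map_zero]
  refine h (WithLp.toLp 2 x) ?_
  have hi (i : Fin 2) : 0 < x i ∧ x i < r / 2 := hx i (mem_univ i)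
  rw [mem_ball_zero_iff, EuclideanSpace.norm_eq, Real.sqrt_lt' hr]
  simp only [Fin.sum_univ_two, Real.norm_eq_abs, sq_abs]
  nlinarith [hi 0, hi 1, (hi 0).1, (hi 0).2, (hi 1).1, (hi 1).2]

/-! ### Local inverse estimates on the reference configuration -/

/-- Multiplication by `b` of polynomials of bounded degree. -/
noncomputable def mulPolyLinear (N : ℕ) (b : Plane → ℝ) :
    MvPolynomial.restrictTotalDegree (Fin 2) ℝ N →ₗ[ℝ] Plane → ℝ :=
  LinearMap.mulLeft ℝ b ∘ₗ polyFunLinear N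

theorem mulPolyLinear_apply (N : ℕ) (b : Plane → ℝ)
    (q : MvPolynomial.restrictTotalDegree (Fin 2) ℝ N) :
    mulPolyLinear N b q = fun x => b x * polyFun q x := rfl

/-- The directional derivative of `b * q` for polynomials `q` of bounded degree. -/
noncomputable def fderivMulPolyLinear (N : ℕ) (b : Plane → ℝ) (hb : ContDiff ℝ ∞ b) (v : Plane) :
    MvPolynomial.restrictTotalDegree (Fin 2) ℝ N →ₗ[ℝ] Plane → ℝ where
  toFun q x := fderiv ℝ (mulPolyLinear N b q) x v
  map_add' p q := by
    have hd (q) : Differentiable ℝ (mulPolyLinear N b q) :=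
      (hb.mul (contDiff_polyFun q)).differentiable (by simp)
    ext x
    rw [map_add, fderiv_add (hd p x) (hd q x)]
    rfl
  map_smul' r q := by
    have hd : Differentiable ℝ (mulPolyLinear N b q) :=
      (hb.mul (contDiff_polyFun q)).differentiable (by simp)
    ext x
    rw [map_smul, fderiv_const_smul (hd x)]
    rfl

theorem exists_inverse_estimate_bump (N : ℕ) (b : ContDiffBump (0 : Plane)) :
    ∃ C : ℝ, 0 < C ∧ ∀ q : MvPolynomial (Fin 2) ℝ, q.totalDegree ≤ N →
      (eLpNorm ((closedBall 0 1).indicator (polyFun q)) 2 volume ≤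
        ENNReal.ofReal C * eLpNorm (fun x => b x * polyFun q x) 2 volume) ∧
      ∀ i : Fin 2, eLpNorm (fun x => fderiv ℝ (fun x => b x ^ 2 * polyFun q x) x
        (EuclideanSpace.basisFun (Fin 2) ℝ i)) 2 volume ≤
          ENNReal.ofReal C * eLpNorm (fun x => b x * polyFun q x) 2 volume := by
  have hb : ContDiff ℝ ∞ b := b.contDiff
  have hb2 : ContDiff ℝ ∞ fun x => b x ^ 2 := hb.pow 2
  have hf (q) : MemLp (mulPolyLinear N b q) 2 volume :=
    (hb.mul (contDiff_polyFun q)).continuous.memLp_of_hasCompactSupport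
      (b.hasCompactSupport.mul_right)
  have hg (v) (q) : MemLp (fderivMulPolyLinear N (fun x => b x ^ 2) hb2 v q) 2 volume := by
    refine Continuous.memLp_of_hasCompactSupport ?_ ?_
    · exact ((hb2.mul (contDiff_polyFun q)).continuous_fderiv (by simp)).clm_apply continuous_const
    · refine HasCompactSupport.fderiv_apply (𝕜 := ℝ) ?_ v
      have : HasCompactSupport fun x => b x * b x := b.hasCompactSupport.mul_right
      refine HasCompactSupport.mul_right ?_
      simpa only [sq] using this
  -- By continuity `b q` vanishes everywhere, and `b = 1` on a ball around the origin.
  have hinj (q) (h : mulPolyLinear N b q =ᵐ[volume] 0) : q = 0 := by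
    have h0 : mulPolyLinear N b q = 0 := by
      refine (Continuous.ae_eq_iff_eq volume ?_ continuous_const).1 h
      exact (hb.mul (contDiff_polyFun q)).continuous
    refine Subtype.ext (eq_zero_of_polyFun_eq_zero_on_ball b.rIn_pos fun x hx => ?_)
    have h1 := congrFun h0 x
    simpa only [mulPolyLinear_apply, b.one_of_mem_closedBall (ball_subset_closedBall hx), one_mul,
      Pi.zero_apply] using h1
  let ind : MvPolynomial.restrictTotalDegree (Fin 2) ℝ N →ₗ[ℝ] Plane → ℝ :=
    mulPolyLinear N ((closedBall 0 1).indicator 1)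
  have hind_eq (q) : ind q = (closedBall 0 1).indicator (polyFun q) := by
    ext x
    simp only [ind, mulPolyLinear_apply, indicator]
    split_ifs <;> simp
  have hind (q) : MemLp (ind q) 2 volume := by
    rw [hind_eq, memLp_indicator_iff_restrict measurableSet_closedBall]
    have hq := (contDiff_polyFun q).continuous
    have hK := isCompact_closedBall (0 : Plane) 1
    obtain ⟨M, hM⟩ := hK.exists_bound_of_continuousOn hq.continuousOn
    have : IsFiniteMeasure (volume.restrict (closedBall (0 : Plane) 1)) :=
      isFiniteMeasure_restrict.2 hK.measure_ne_top
    exact MemLp.of_bound hq.aestronglyMeasurable M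
      (ae_restrict_of_forall_mem measurableSet_closedBall hM)
  obtain ⟨C₀, hC₀, h₀⟩ := exists_eLpNorm_le_mul_eLpNorm _ _ hf hind hinj
  have hder (i : Fin 2) := exists_eLpNorm_le_mul_eLpNorm _ _ hf
    (hg (EuclideanSpace.basisFun (Fin 2) ℝ i)) hinj
  choose C₁ hC₁ h₁ using hder
  refine ⟨C₀ + ∑ i, C₁ i, add_pos_of_pos_of_nonneg hC₀ (Finset.sum_nonneg fun i _ => (hC₁ i).le),
    fun q hq => ?_⟩
  let q' : MvPolynomial.restrictTotalDegree (Fin 2) ℝ N :=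
    ⟨q, (MvPolynomial.mem_restrictTotalDegree _ _ _).2 hq⟩
  constructor
  · refine (hind_eq q' ▸ h₀ q').trans ?_
    refine mul_le_mul_left (ENNReal.ofReal_le_ofReal ?_) _
    exact le_add_of_nonneg_right (Finset.sum_nonneg fun i _ => (hC₁ i).le)
  · intro i
    refine (h₁ i q').trans ?_
    refine mul_le_mul_left (ENNReal.ofReal_le_ofReal ?_) _
    exact (Finset.single_le_sum (fun i _ => (hC₁ i).le) (Finset.mem_univ i)).trans
      (le_add_of_nonneg_left hC₀.le)

/-! ### Scaling -/

/-- In dimension two the Jacobian is `h²`, whose square root is `h`. -/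
theorem eLpNorm_comp_rescale {f : Plane → ℝ} (hf : StronglyMeasurable f) (c : Plane) {h : ℝ}
    (hh : 0 < h) :
    eLpNorm (fun x => f (h⁻¹ • (x - c))) 2 volume = ENNReal.ofReal h * eLpNorm f 2 volume := by
  have h1 : eLpNorm (fun x => f (h⁻¹ • (x - c))) 2 volume
      = eLpNorm (fun x => f (h⁻¹ • x)) 2 volume :=
    eLpNorm_comp_measurePreserving (g := fun x => f (h⁻¹ • x))
      (hf.comp_measurable (measurable_const_smul _)).aestronglyMeasurable
      (measurePreserving_sub_right volume c)
  have h2 := eLpNorm_map_measure (μ := volume) (p := 2) (f := fun x : Plane => h⁻¹ • x)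
    hf.aestronglyMeasurable (measurable_const_smul h⁻¹).aemeasurable
  rw [h1]
  refine h2.symm.trans ?_
  rw [Measure.map_addHaar_smul volume (inv_ne_zero hh.ne'),
    eLpNorm_smul_measure_of_ne_top (by simp), smul_eq_mul]
  congr 1
  rw [finrank_euclideanSpace_fin, inv_pow, inv_inv, abs_of_nonneg (by positivity),
    ENNReal.ofReal_rpow_of_nonneg (by positivity) (by simp)]
  congr 1
  rw [← Real.rpow_natCast, ← Real.rpow_mul hh.le]
  simp

theorem fderiv_comp_rescale (f : Plane → ℝ) (c : Plane) (h : ℝ) (x v : Plane) :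
    fderiv ℝ (fun x => f (h⁻¹ • (x - c))) x v = h⁻¹ * fderiv ℝ f (h⁻¹ • (x - c)) v := by
  rw [fderiv_comp_sub (f := fun x => f (h⁻¹ • x)), fderiv_comp_smul]
  rfl

/-! ### Weak gradient and weak Laplacian -/

theorem IsTestFunction.fderiv_apply {E : Set Plane} {φ : Plane → ℝ} (hφ : IsTestFunction E φ)
    (v : Plane) : IsTestFunction E fun x => fderiv ℝ φ x v where
  smooth := (hφ.smooth.fderiv_right (m := ∞) (by simp)).clm_apply contDiff_const
  compact := hφ.compact.fderiv_apply (𝕜 := ℝ) v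
  support := by
    refine (closure_mono ?_).trans ((tsupport_fderiv_subset ℝ (f := φ)).trans hφ.support)
    intro x hx h0
    exact hx (by simp only [h0, zero_apply])

theorem IsTestFunction.laplacian_eq {E : Set Plane} {φ : Plane → ℝ} (hφ : IsTestFunction E φ) :
    Laplacian.laplacian φ = fun x => ∑ i, fderiv ℝ
      (fun y => fderiv ℝ φ y (EuclideanSpace.basisFun (Fin 2) ℝ i)) x
        (EuclideanSpace.basisFun (Fin 2) ℝ i) := by
  rw [InnerProductSpace.laplacian_eq_iteratedFDeriv_orthonormalBasis φ
    (EuclideanSpace.basisFun (Fin 2) ℝ)]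
  ext x
  refine Finset.sum_congr rfl fun i _ => ?_
  have hd : DifferentiableAt ℝ (fderiv ℝ φ) x :=
    (hφ.smooth.fderiv_right (m := ∞) (by simp)).differentiable (by simp) x
  rw [iteratedFDeriv_two_apply, fderiv_clm_apply hd (differentiableAt_const _)]
  simp

/-- The weak form of the Poisson equation, tested against a smooth function. -/
theorem HasWeakLaplacian.integral_mul_eq {E : Set Plane} {w f : Plane → ℝ} {g : Plane → Plane}
    (hf : HasWeakLaplacian E w f) (hw : MemLp w 2 (volume.restrict E)) (hg : HasWeakGradient E w g)
    {φ : Plane → ℝ} (hφ : IsTestFunction E φ) :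
    ∫ x in E, f x * φ x = ∑ i, -∫ x in E, ⟪g x, EuclideanSpace.basisFun (Fin 2) ℝ i⟫_ℝ *
      fderiv ℝ φ x (EuclideanSpace.basisFun (Fin 2) ℝ i) := by
  rw [← hf.integral_eq φ hφ, hφ.laplacian_eq]
  simp only [Finset.mul_sum]
  rw [integral_finsetSum]
  -- The test function here is `∂ᵢφ`, in direction `eᵢ`.
  · exact Finset.sum_congr rfl fun i _ => hg.integral_eq _ (hφ.fderiv_apply _) _
  · intro i _
    have h2 := (hφ.fderiv_apply (EuclideanSpace.basisFun (Fin 2) ℝ i)).fderiv_apply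
      (EuclideanSpace.basisFun (Fin 2) ℝ i)
    have h3 := (h2.smooth.continuous.memLp_of_hasCompactSupport (μ := volume) (p := 2)
      h2.compact).restrict E
    exact hw.integrable_mul h3

theorem enorm_integral_inner_mul_le {μ : Measure Plane} {g : Plane → Plane} {ψ : Plane → ℝ}
    (hg : AEStronglyMeasurable g μ) (hψ : AEStronglyMeasurable ψ μ) {v : Plane} (hv : ‖v‖ = 1) :
    ‖∫ x, ⟪g x, v⟫_ℝ * ψ x ∂μ‖ₑ ≤ eLpNorm g 2 μ * eLpNorm ψ 2 μ := by
  calc ‖∫ x, ⟪g x, v⟫_ℝ * ψ x ∂μ‖ₑ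
      ≤ ∫⁻ x, ‖⟪g x, v⟫_ℝ * ψ x‖ₑ ∂μ := enorm_integral_le_lintegral_enorm _
    _ = eLpNorm ((fun x => ⟪g x, v⟫_ℝ) • ψ) 1 μ := by rw [eLpNorm_one_eq_lintegral_enorm]; rfl
    _ ≤ eLpNorm (fun x => ⟪g x, v⟫_ℝ) 2 μ * eLpNorm ψ 2 μ :=
      eLpNorm_smul_le_mul_eLpNorm hψ (hg.inner aestronglyMeasurable_const)
    _ ≤ eLpNorm g 2 μ * eLpNorm ψ 2 μ := by
      gcongr
      refine eLpNorm_mono fun x => ?_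
      simpa [hv] using norm_inner_le_norm (𝕜 := ℝ) (g x) v

theorem eLpNorm_two_sq_eq_enorm_integral {μ : Measure Plane} {u : Plane → ℝ}
    (hu : MemLp u 2 μ) : eLpNorm u 2 μ ^ 2 = ‖∫ x, u x ^ 2 ∂μ‖ₑ := by
  have h0 : 0 ≤ ∫ x, u x ^ 2 ∂μ := integral_nonneg fun x => sq_nonneg _
  rw [Real.enorm_eq_ofReal h0, ofReal_integral_eq_lintegral_ofReal hu.integrable_sq
    (Filter.Eventually.of_forall fun x => sq_nonneg _),
    eLpNorm_eq_lintegral_rpow_enorm_toReal (by simp) (by simp)]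
  rw [← ENNReal.rpow_natCast, ← ENNReal.rpow_mul]
  simp only [ENNReal.toReal_ofNat, Nat.cast_ofNat, one_div, ne_eq, OfNat.ofNat_ne_zero,
    not_false_eq_true, inv_mul_cancel₀, ENNReal.rpow_one]
  refine lintegral_congr fun x => ?_
  rw [← sq_abs, ENNReal.ofReal_pow (abs_nonneg _), ← Real.enorm_eq_ofReal_abs]
  exact ENNReal.rpow_ofNat _ 2

theorem inverse_estimate_of_ball_subset {N : ℕ} {b : ContDiffBump (0 : Plane)} {C : ℝ} (hC : 0 < C)
    (hest : ∀ q : MvPolynomial (Fin 2) ℝ, q.totalDegree ≤ N →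
      (eLpNorm ((closedBall 0 1).indicator (polyFun q)) 2 volume ≤
        ENNReal.ofReal C * eLpNorm (fun x => b x * polyFun q x) 2 volume) ∧
      ∀ i : Fin 2, eLpNorm (fun x => fderiv ℝ (fun x => b x ^ 2 * polyFun q x) x
        (EuclideanSpace.basisFun (Fin 2) ℝ i)) 2 volume ≤
          ENNReal.ofReal C * eLpNorm (fun x => b x * polyFun q x) 2 volume)
    {E : Set Plane} (hE : MeasurableSet E) {c : Plane} {h : ℝ} (hh : 0 < h)
    (hball : closedBall c (h * b.rOut) ⊆ E) (hsub : E ⊆ closedBall c h)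
    {w : Plane → ℝ} (hw : MemLp w 2 (volume.restrict E))
    {g : Plane → Plane} (hg : HasWeakGradient E w g)
    {p : MvPolynomial (Fin 2) ℝ} (hp : p.totalDegree ≤ N) (hlap : HasWeakLaplacian E w (polyFun p)) :
    eLpNorm (polyFun p) 2 (volume.restrict E) ≤
      ENNReal.ofReal (2 * C ^ 2 * h⁻¹) * eLpNorm g 2 (volume.restrict E) := by
  set q := rescalePoly c h p with hq
  have hqp (x : Plane) : polyFun q (h⁻¹ • (x - c)) = polyFun p x := by
    rw [hq, polyFun_rescalePoly, smul_inv_smul₀ hh.ne', add_sub_cancel]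
  obtain ⟨h1, h2⟩ := hest q ((totalDegree_rescalePoly_le c h p).trans hp)
  set t := eLpNorm (fun x => b x * polyFun q x) 2 volume
  set G := eLpNorm g 2 (volume.restrict E)
  have hcq := (contDiff_polyFun q).continuous
  have htop : t ≠ ⊤ :=
    ((b.continuous.mul hcq).memLp_of_hasCompactSupport b.hasCompactSupport.mul_right).eLpNorm_ne_top
  have hzero (x : Plane) (hx : x ∉ closedBall c (h * b.rOut)) : b (h⁻¹ • (x - c)) = 0 := by
    refine b.zero_of_le_dist ?_
    rw [mem_closedBall, not_le, dist_eq_norm] at hx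
    rw [dist_zero_right, norm_smul, norm_inv, Real.norm_of_nonneg hh.le, ← div_eq_inv_mul,
      le_div_iff₀ hh]
    linarith
  let u : Plane → ℝ := fun x => b (h⁻¹ • (x - c)) * polyFun p x
  let φ : Plane → ℝ := fun x => b (h⁻¹ • (x - c)) ^ 2 * polyFun p x
  have hφeq : φ = fun x => (fun y => b y ^ 2 * polyFun q y) (h⁻¹ • (x - c)) := by
    ext x; simp only [φ, hqp]
  have hueq : u = fun x => (fun y => b y * polyFun q y) (h⁻¹ • (x - c)) := by
    ext x; simp only [u, hqp]
  have hbs : ContDiff ℝ ∞ fun x => b (h⁻¹ • (x - c)) :=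
    b.contDiff.comp (by fun_prop)
  have hφ : IsTestFunction E φ := by
    have hs : tsupport φ ⊆ closedBall c (h * b.rOut) := by
      refine closure_minimal (fun x hx => ?_) isClosed_closedBall
      by_contra hx'
      exact hx (by simp [φ, hzero x hx'])
    exact ⟨(hbs.pow 2).mul (contDiff_polyFun p),
      (isCompact_closedBall c (h * b.rOut)).of_isClosed_subset (isClosed_tsupport φ) hs,
      hs.trans hball⟩
  have hu0 (x : Plane) (hx : x ∉ E) : u x = 0 := by
    simp only [u, hzero x fun hx' => hx (hball hx'), zero_mul]
  have hu : MemLp u 2 (volume.restrict E) := by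
    refine MemLp.restrict E (Continuous.memLp_of_hasCompactSupport ?_ ?_)
    · exact hbs.continuous.mul (contDiff_polyFun p).continuous
    · exact HasCompactSupport.intro (isCompact_closedBall c (h * b.rOut)) fun x hx => by
        simp only [u, hzero x hx, zero_mul]
  have hunorm : eLpNorm u 2 (volume.restrict E) = ENNReal.ofReal h * t := by
    rw [← eLpNorm_indicator_eq_eLpNorm_restrict hE, indicator_eq_self.2, hueq]
    · exact eLpNorm_comp_rescale (b.continuous.mul hcq).stronglyMeasurable c hh
    intro x hx
    by_contra hx'
    exact hx (hu0 x hx')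
  have hder (i : Fin 2) : eLpNorm (fun x => fderiv ℝ φ x (EuclideanSpace.basisFun (Fin 2) ℝ i)) 2
      (volume.restrict E) ≤ ENNReal.ofReal C * t := by
    -- The `h⁻¹` from the chain rule cancels the `h` from the change of variables.
    refine (eLpNorm_restrict_le _ _ _ _).trans (le_trans (le_of_eq ?_) (h2 i))
    rw [hφeq]
    simp only [fderiv_comp_rescale fun y => b y ^ 2 * polyFun q y]
    have hbb : ContDiff ℝ ∞ b := b.contDiff
    have hsm : Continuous fun x => fderiv ℝ (fun x => b x ^ 2 * polyFun q x) x
        (EuclideanSpace.basisFun (Fin 2) ℝ i) :=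
      ((hbb.pow 2).mul (contDiff_polyFun q)).continuous_fderiv (by simp)
        |>.clm_apply continuous_const
    have := eLpNorm_const_smul h⁻¹ (fun x => (fun y => fderiv ℝ (fun x => b x ^ 2 * polyFun q x) y
        (EuclideanSpace.basisFun (Fin 2) ℝ i)) (h⁻¹ • (x - c))) 2 volume
    refine this.trans ?_
    rw [eLpNorm_comp_rescale hsm.stronglyMeasurable c hh, ← mul_assoc, Real.enorm_eq_ofReal
      (by positivity), ← ENNReal.ofReal_mul (by positivity), inv_mul_cancel₀ hh.ne']
    simp
  have hgm : AEStronglyMeasurable g (volume.restrict E) :=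
    hg.locallyIntegrable_grad.aestronglyMeasurable
  have hmain : (ENNReal.ofReal h * t) ^ 2 ≤ 2 * (G * (ENNReal.ofReal C * t)) := by
    rw [← hunorm, eLpNorm_two_sq_eq_enorm_integral hu]
    -- This is why the test function carries `b²`. The factor 2 in the bound counts the coordinates.
    have : ∀ x, u x ^ 2 = polyFun p x * φ x := fun x => by simp only [u, φ]; ring
    simp only [this]
    rw [hlap.integral_mul_eq hw hg hφ]
    refine (enorm_sum_le _ _).trans ((Finset.sum_le_card_nsmul _ _
      (G * (ENNReal.ofReal C * t)) fun i _ => ?_).trans (by simp))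
    rw [enorm_neg]
    refine (enorm_integral_inner_mul_le hgm (hφ.fderiv_apply _).smooth.continuous.aestronglyMeasurable
      ((EuclideanSpace.basisFun (Fin 2) ℝ).norm_eq_one i)).trans ?_
    gcongr
    exact hder i
  have hpE : eLpNorm (polyFun p) 2 (volume.restrict E) ≤
      ENNReal.ofReal h * (ENNReal.ofReal C * t) := by
    refine le_trans ?_ (mul_le_mul_right h1 _)
    rw [← eLpNorm_comp_rescale ((hcq.stronglyMeasurable).indicator measurableSet_closedBall) c hh,
      ← eLpNorm_indicator_eq_eLpNorm_restrict hE]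
    refine eLpNorm_mono fun x => ?_
    by_cases hx : x ∈ E
    · have : h⁻¹ • (x - c) ∈ closedBall (0 : Plane) 1 := by
        have h3 := hsub hx
        rw [mem_closedBall, dist_eq_norm] at h3
        rw [mem_closedBall_zero_iff, norm_smul, norm_inv, Real.norm_of_nonneg hh.le,
          ← div_eq_inv_mul]
        exact (div_le_one hh).2 h3
      rw [indicator_of_mem hx, indicator_of_mem this, hqp]
    · rw [indicator_of_notMem hx]
      simp
  -- One factor `t` is about to be cancelled, which needs it nonzero and finite; if `t = 0`, then
  -- `hpE` already suffices.
  rcases eq_or_ne t 0 with h0 | h0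
  · simp [h0] at hpE
    simp [hpE]
  have hkey : ENNReal.ofReal h ^ 2 * t ≤ 2 * ENNReal.ofReal C * G := by
    refine (ENNReal.mul_le_mul_iff_left h0 htop).1 (le_trans (le_of_eq ?_) (hmain.trans (le_of_eq ?_)))
    all_goals ring
  have hne : ENNReal.ofReal h ≠ 0 := by simpa using hh
  calc eLpNorm (polyFun p) 2 (volume.restrict E)
      ≤ ENNReal.ofReal h * (ENNReal.ofReal C * t) := hpE
    _ = ENNReal.ofReal (C * h⁻¹) * (ENNReal.ofReal h ^ 2 * t) := by
      have : ENNReal.ofReal (C * h⁻¹) * ENNReal.ofReal h ^ 2 =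
          ENNReal.ofReal h * ENNReal.ofReal C := by
        rw [← ENNReal.ofReal_pow hh.le, ← ENNReal.ofReal_mul (by positivity),
          ← ENNReal.ofReal_mul hh.le]
        congr 1
        field_simp
      rw [← mul_assoc, ← mul_assoc, this]
    _ ≤ ENNReal.ofReal (C * h⁻¹) * (2 * ENNReal.ofReal C * G) := by gcongr
    _ = ENNReal.ofReal (2 * C ^ 2 * h⁻¹) * G := by
      rw [← ENNReal.ofReal_ofNat 2, ← ENNReal.ofReal_mul (by positivity), ← mul_assoc,
        ← ENNReal.ofReal_mul (by positivity)]
      congr 2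
      ring

theorem mainTheorem2 (k ℓ : ℕ) (hk : 1 ≤ k) (κ : ℝ) (hκ : 0 < κ) :
    ∃ C_I : ℝ, 0 < C_I ∧
      ∀ (n : ℕ) (P : Polygon Plane n) (E : Set Plane),
        IsPolygonalRegion P E → IsShapeRegular κ P E →
        ∀ w : Plane → ℝ, MemH1 E w →
        ∀ gradw : Plane → Plane, HasWeakGradient E w gradw →
        ∀ p : MvPolynomial (Fin 2) ℝ, p.totalDegree ≤ k + ℓ →
          HasWeakLaplacian E w (polyFun p) →
          eLpNorm (polyFun p) 2 (volume.restrict E) ≤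
            ENNReal.ofReal (C_I * (diam E)⁻¹) * eLpNorm gradw 2 (volume.restrict E) := by
  -- The outer radius is strictly below `κ`, so that after scaling the closed support lies in the
  -- open ball of radius `ρ`; the inner radius is any smaller positive number.
  let b : ContDiffBump (0 : Plane) := ⟨κ / 4, κ / 2, by positivity, by linarith⟩
  obtain ⟨C, hC, hest⟩ := exists_inverse_estimate_bump (k + ℓ) b
  refine ⟨2 * C ^ 2, by positivity, ?_⟩
  rintro n P E hE ⟨⟨c, ρ, hρ, hstar⟩, -⟩ w ⟨hw, -⟩ g hg p hp hlap
  have hne : E.Nonempty := hE.isConnected.nonempty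
  have hdiam : 0 < diam E := by
    obtain ⟨x, hx⟩ := hne
    have hnt : E.Nontrivial := by
      by_contra hs
      rw [not_nontrivial_iff] at hs
      have h1 : E = {x} := hs.eq_singleton_of_mem hx
      exact not_isOpen_singleton x (h1 ▸ hE.isOpen)
    exact diam_pos hnt hE.isBounded
  have hball : ball c ρ ⊆ E := fun y hy => (hstar y hy).mem_of_nonempty hne
  have hκd : 0 < κ * diam E := by positivity
  have hc : c ∈ E := hball (mem_ball_self (hκd.trans_le hρ))
  refine inverse_estimate_of_ball_subset hC hest hE.isOpen.measurableSet hdiam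
    ((closedBall_subset_ball ?_).trans hball) (fun x hx => dist_le_diam_of_mem hE.isBounded hx hc)
    hw hg hp hlap
  change diam E * (κ / 2) < ρ
  linarith
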